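/- Let $\tau\in\mathbb C$ with $\operatorname{Im}\tau>0$, put $q=e^{i\pi\tau}$ (with $q^s:=e^{i\pi\tau s}$), and let $$\theta(z)=i\sum_{n\in\mathbb Z}(-1)^n q^{(n-1/2)^2}e^{i\pi(2n-1)z},\qquad z\in\mathbb C.$$ Let $\eta\in\mathbb C$, $\mu\in\mathbb C\setminus\{0\}$, let $k\ge 1$ be an integer, and set $P_k(\eta,z)=\prod_{\ell=0}^{k-1}\theta(2z+2\ell\eta)$. Let $V_k(\mu)$ be the complex vector space of all meromorphic functions $g$ on $\mathbb C$ such that $$g(z+1)=g(z),\qquad g(z+\tau)=\mu^k g(z),$$ and such that $g(z)P_k(\eta,z)$ is entire (after removing removable singularities). Then $V_k(\mu)$ has dimension $4k$. Moreover, there is a $\nu\in\mathbb C$ with $e^{8i\pi\nu}=\mu$ and $0\le\operatorname{Re}\nu<1/4$ such that every $g\in V_k(\mu)$ can be written as $$g(z)=\frac{c\,\prod_{i=1}^{4k}\theta(z+a_i-\nu)}{P_k(\eta,z)}$$ for some $c\in\mathbb C$ and $a=(a_1,\dots,a_{4k})\in\mathbb C^{4k}$ with $\sum_{i=1}^{4k}a_i=2k(k-1)\eta$.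 -/

import Mathlib

open Filter

namespace Sklyanin

/-- The odd Jacobi theta function
`θ(z) = i ∑_{n ∈ ℤ} (-1)^n q^((n-1/2)^2) exp(iπ(2n-1)z)` with `q = exp(iπτ)`,
where `q^s` stands for `exp(iπτs)`. -/
noncomputable def theta (τ z : ℂ) : ℂ :=
  Complex.I * ∑' n : ℤ, (-1 : ℂ) ^ n *
    Complex.exp (Complex.I * Real.pi * τ * ((n : ℂ) - 1 / 2) ^ 2) *
    Complex.exp (Complex.I * Real.pi * (2 * (n : ℂ) - 1) * z)

/-- `P_k(η,z) = ∏_{ℓ=0}^{k-1} θ(2z + 2ℓη)`. -/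
noncomputable def thetaDen (τ η : ℂ) (k : ℕ) (z : ℂ) : ℂ :=
  ∏ l ∈ Finset.range k, theta τ (2 * z + 2 * (l : ℂ) * η)

/-- The defining properties of the elements of `V_k(μ)`, for a function `g : ℂ → ℂ` that represents
a meromorphic function. The values of `g` on a set without accumulation points in `ℂ`
(for instance the values assigned at the poles) carry no information, so all identities are
identities of meromorphic functions: they hold off such a set. -/
structure IsQuasiPeriodic (τ η μ : ℂ) (k : ℕ) (g : ℂ → ℂ) : Prop where
  meromorphic : Meromorphic g
  add_one : ∀ᶠ z in codiscrete ℂ, g (z + 1) = g z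
  add_tau : ∀ᶠ z in codiscrete ℂ, g (z + τ) = μ ^ k * g z
  entire : ∃ h : ℂ → ℂ, Differentiable ℂ h ∧ ∀ᶠ z in codiscrete ℂ, g z * thetaDen τ η k z = h z

/-- The vector space `V_k(μ)`. A meromorphic function on `ℂ` is a function `g : ℂ → ℂ` with
`Meromorphic g`, up to equality off a set without accumulation points in `ℂ`, i.e. its class
in `Germ (codiscrete ℂ) ℂ`. -/
noncomputable def V (τ η μ : ℂ) (k : ℕ) : Submodule ℂ (Germ (codiscrete ℂ) ℂ) where
  carrier := {G | ∃ g : ℂ → ℂ, IsQuasiPeriodic τ η μ k g ∧ G = (g : Germ (codiscrete ℂ) ℂ)}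
  zero_mem' := by
    refine ⟨fun _ => 0, ⟨fun z => MeromorphicAt.const 0 z, ?_, ?_, fun _ => 0, ?_, ?_⟩, rfl⟩ <;> simp
  add_mem' := by
    rintro _ _ ⟨f, hf, rfl⟩ ⟨g, hg, rfl⟩
    refine ⟨f + g, ⟨fun z => (hf.meromorphic z).add (hg.meromorphic z), ?_, ?_, ?_⟩, rfl⟩
    · filter_upwards [hf.add_one, hg.add_one] with z h1 h2
      simp [h1, h2]
    · filter_upwards [hf.add_tau, hg.add_tau] with z h1 h2
      simp [h1, h2, mul_add]
    · obtain ⟨u, hu, hu2⟩ := hf.entire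
      obtain ⟨v, hv, hv2⟩ := hg.entire
      refine ⟨u + v, hu.add hv, ?_⟩
      filter_upwards [hu2, hv2] with z h1 h2
      simp [← h1, ← h2, add_mul]
  smul_mem' := by
    rintro c _ ⟨f, hf, rfl⟩
    refine ⟨c • f, ⟨fun z => (MeromorphicAt.const c z).smul (hf.meromorphic z), ?_, ?_, ?_⟩, rfl⟩
    · filter_upwards [hf.add_one] with z h1
      simp [h1]
    · filter_upwards [hf.add_tau] with z h1
      simp [h1, mul_left_comm]
    · obtain ⟨u, hu, hu2⟩ := hf.entire
      refine ⟨c • u, hu.const_smul c, ?_⟩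
      filter_upwards [hu2] with z h1
      simp [← h1, mul_assoc]

end Sklyanin

namespace Sklyanin

open Complex Topology
open scoped Real

/-! Multiplication by `P_k` turns `V_k(μ)` into a space of entire functions: `P_k` has period `1`
and acquires `C exp(-8πikz)` under `z ↦ z + τ`, so the numerators `g P_k` are exactly the theta
functions of degree `4k` with multiplier constant `numConst` (`nonempty_thetaSpace_equiv_V`). Both
claims then concern theta functions of degree `N`.

The tool is division. The product `thetaProd` has simple zeros, exactly at `ℤ + ℤτ`, so a zero `w`
of a theta function can be divided out, which lowers the degree by one
(`IsTheta.exists_div_thetaProd`). A function of degree `-1` vanishes, one of degree `0` is zero or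
`c exp(2πimz)`, and one of nonzero degree has a zero. This replaces counting zeros by contour
integrals.

Dimension: evaluation at `N` suitable points is bijective onto `ℂ^N` (`bijective_eval`).
Factorization: dividing out zeros until the degree is `0` gives a product of `N` shifted thetas
times an exponential (`IsTheta.exists_eq_prod`). Comparing multipliers fixes the sum of the zeros
modulo `ℤ + ℤτ`; moving one zero by a lattice vector makes the sum exact and absorbs the exponential
(`IsTheta.exists_eq_prod_theta`). -/

/-- An entire function with two `ℝ`-independent periods is constant. -/
lemma apply_eq_apply_zero_of_doubly_periodic {τ : ℂ} (hτ : 0 < τ.im) {f : ℂ → ℂ}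
    (hf : Differentiable ℂ f) (h1 : ∀ z, f (z + 1) = f z) (h2 : ∀ z, f (z + τ) = f z) (z : ℂ) :
    f z = f 0 := by
  refine hf.apply_eq_apply_of_bounded ?_ z 0
  have hc : IsCompact ((fun p : ℝ × ℝ => f (p.1 + p.2 * τ)) '' (Set.Icc 0 1 ×ˢ Set.Icc 0 1)) := by
    refine (isCompact_Icc.prod isCompact_Icc).image ?_
    have := hf.continuous
    fun_prop
  refine hc.isBounded.subset ?_
  rintro _ ⟨w, rfl⟩
  -- Real coordinates of `w` in the basis `1, τ`; their fractional parts give an equivalent point of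
  -- the compact period parallelogram.
  set y : ℝ := w.im / τ.im with hy
  set x : ℝ := w.re - y * τ.re with hx
  have hw : w = x + y * τ := by
    apply Complex.ext
    · simp [hx]
    · simp [hy, hτ.ne']
  refine ⟨(Int.fract x, Int.fract y), ⟨⟨Int.fract_nonneg _, (Int.fract_lt_one _).le⟩,
    ⟨Int.fract_nonneg _, (Int.fract_lt_one _).le⟩⟩, ?_⟩
  have p1 : Function.Periodic f 1 := h1
  have p2 : Function.Periodic f τ := h2
  have e1 := p1.int_mul ⌊x⌋ (Int.fract x + Int.fract y * τ)
  have e2 := p2.int_mul ⌊y⌋ (Int.fract x + Int.fract y * τ + ⌊x⌋ * 1)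
  rw [e1] at e2
  simp only
  rw [← e2, hw]
  congr 1
  have hx' : (x : ℂ) = ⌊x⌋ + Int.fract x := by exact_mod_cast (Int.floor_add_fract x).symm
  have hy' : (y : ℂ) = ⌊y⌋ + Int.fract y := by exact_mod_cast (Int.floor_add_fract y).symm
  rw [hx', hy']
  ring

lemma analyticOnNhd_univ {f : ℂ → ℂ} (hf : Differentiable ℂ f) : AnalyticOnNhd ℂ f Set.univ :=
  fun z _ => hf.analyticAt z

lemma eventually_codiscrete_ne_zero {f : ℂ → ℂ} (hf : Differentiable ℂ f) {w : ℂ} (hw : f w ≠ 0) :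
    ∀ᶠ z in codiscrete ℂ, f z ≠ 0 :=
  (analyticOnNhd_univ hf).preimage_zero_mem_codiscreteWithin (x := w) hw (Set.mem_univ _)
    isConnected_univ

lemma eq_of_eventually_codiscrete_eq {f g : ℂ → ℂ} (hf : Continuous f) (hg : Continuous g)
    (h : ∀ᶠ z in codiscrete ℂ, f z = g z) (z : ℂ) : f z = g z := by
  have h2 : ∀ᶠ w in 𝓝[≠] z, f w = g w := by
    have := (mem_codiscreteWithin_iff_forall_mem_nhdsNE.mp h) z (Set.mem_univ _)
    filter_upwards [this] with w hw
    simpa using hw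
  exact tendsto_nhds_unique_of_eventuallyEq (hf.continuousAt.tendsto.mono_left nhdsWithin_le_nhds)
    (hg.continuousAt.tendsto.mono_left nhdsWithin_le_nhds) h2

lemma tendsto_add_const_codiscrete (c : ℂ) :
    Tendsto (fun z : ℂ => z + c) (codiscrete ℂ) (codiscrete ℂ) := by
  intro s hs
  rw [mem_map, codiscrete, mem_codiscreteWithin_iff_forall_mem_nhdsNE]
  intro x _
  have h1 := (mem_codiscreteWithin_iff_forall_mem_nhdsNE.mp hs) (x + c) (Set.mem_univ _)
  have h2 : Tendsto (fun z : ℂ => z + c) (𝓝[≠] x) (𝓝[≠] (x + c)) := by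
    refine tendsto_nhdsWithin_iff.mpr ⟨?_, ?_⟩
    · exact (by fun_prop : Continuous fun z : ℂ => z + c).continuousAt.tendsto.mono_left
        nhdsWithin_le_nhds
    · filter_upwards [self_mem_nhdsWithin] with z hz
      simpa using hz
  filter_upwards [h2 h1] with z hz
  simpa using hz

/-- Cancellation of an entire factor that is not identically zero. -/
lemma eq_of_mul_eq_mul {f g s : ℂ → ℂ} (hf : Continuous f) (hg : Continuous g)
    (hs : Differentiable ℂ s) {w : ℂ} (hw : s w ≠ 0) (h : ∀ z, f z * s z = g z * s z) (z : ℂ) :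
    f z = g z := by
  refine eq_of_eventually_codiscrete_eq hf hg ?_ z
  filter_upwards [eventually_codiscrete_ne_zero hs hw] with z hz
  exact mul_right_cancel₀ hz (h z)

/-- An entire function is divisible by an entire function with simple zeros that are all zeros
of the first one. -/
lemma exists_entire_quotient {h s : ℂ → ℂ} (hh : Differentiable ℂ h) (hs : Differentiable ℂ s)
    (hz : ∀ z, s z = 0 → h z = 0 ∧ deriv s z ≠ 0) :
    ∃ f : ℂ → ℂ, Differentiable ℂ f ∧ ∀ z, h z = f z * s z := by
  classical
  -- At a zero of `s` the value is the limit of `h / s`. Near it the quotient equals the quotient of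
  -- the two `dslope`s, which is differentiable since the zero of `s` is simple.
  refine ⟨fun z => if s z = 0 then deriv h z / deriv s z else h z / s z, ?_, ?_⟩
  · intro w
    by_cases hw : s w = 0
    · obtain ⟨hw1, hw2⟩ := hz w hw
      have dh : DifferentiableAt ℂ (dslope h w) w :=
        ((Complex.differentiableOn_dslope univ_mem).mpr hh.differentiableOn).differentiableAt
          univ_mem
      have ds : DifferentiableAt ℂ (dslope s w) w :=
        ((Complex.differentiableOn_dslope univ_mem).mpr hs.differentiableOn).differentiableAt
          univ_mem
      have ds0 : dslope s w w ≠ 0 := by rwa [dslope_same]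
      refine (dh.div ds ds0).congr_of_eventuallyEq ?_
      filter_upwards [ds.continuousAt.eventually_ne ds0] with z hne
      rcases eq_or_ne z w with rfl | hzw
      · simp [hw, dslope_same]
      · have e1 : s z = (z - w) * dslope s w z := by
          have := sub_smul_dslope s w z
          rw [hw, sub_zero, smul_eq_mul] at this
          exact this.symm
        have e2 : h z = (z - w) * dslope h w z := by
          have := sub_smul_dslope h w z
          rw [hw1, sub_zero, smul_eq_mul] at this
          exact this.symm
        have hzw' : z - w ≠ 0 := sub_ne_zero.mpr hzw
        have : s z ≠ 0 := by rw [e1]; exact mul_ne_zero hzw' hne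
        simp only [if_neg this, Pi.div_apply]
        rw [e1, e2, mul_div_mul_left _ _ hzw']
    · refine ((hh w).div (hs w) hw).congr_of_eventuallyEq ?_
      filter_upwards [(hs w).continuousAt.eventually_ne hw] with z hne
      simp [hne]
  · intro z
    by_cases h0 : s z = 0
    · simp [h0, (hz z h0).1]
    · simp [h0]

/-! ### Infinite products and the product form of theta -/

/-- The infinite product `∏_{n ≥ 0} (1 - p^n u)`. -/
noncomputable def qProd (p u : ℂ) : ℂ := ∏' n : ℕ, (1 - p ^ n * u)

lemma summable_norm_pow_mul {p : ℂ} (hp : ‖p‖ < 1) (u : ℂ) :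
    Summable fun n : ℕ => ‖-(p ^ n * u)‖ := by
  simpa using (summable_geometric_of_lt_one (norm_nonneg _) hp).mul_right ‖u‖

lemma multipliable_one_sub_pow_mul {p : ℂ} (hp : ‖p‖ < 1) (u : ℂ) :
    Multipliable fun n : ℕ => 1 - p ^ n * u := by
  simp_rw [sub_eq_add_neg]
  exact multipliable_one_add_of_summable (summable_norm_pow_mul hp u)

lemma qProd_eq {p : ℂ} (hp : ‖p‖ < 1) (u : ℂ) : qProd p u = (1 - u) * qProd p (p * u) := by
  rw [qProd, tprod_eq_zero_mul' (f := fun n => 1 - p ^ n * u)]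
  · simp only [pow_zero, one_mul, qProd]
    congr 2
    ext n
    ring
  · convert multipliable_one_sub_pow_mul hp (p * u) using 2
    ring

lemma exists_of_qProd_eq_zero {p : ℂ} (hp : ‖p‖ < 1) {u : ℂ} (h : qProd p u = 0) :
    ∃ n : ℕ, p ^ n * u = 1 := by
  by_contra! hne
  refine tprod_one_add_ne_zero_of_summable (f := fun n : ℕ => -(p ^ n * u)) ?_
    (summable_norm_pow_mul hp u) (by simpa [qProd, sub_eq_add_neg] using h)
  intro n
  rw [← sub_eq_add_neg, sub_ne_zero]
  exact (hne n).symm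

lemma differentiable_qProd {p : ℂ} (hp : ‖p‖ < 1) : Differentiable ℂ (qProd p) := by
  have key : HasProdLocallyUniformlyOn (fun (n : ℕ) (u : ℂ) => 1 - p ^ n * u) (qProd p)
      Set.univ := by
    simp_rw [sub_eq_add_neg]
    have : qProd p = fun u => ∏' n : ℕ, (1 + -(p ^ n * u)) := by
      ext u; simp [qProd, sub_eq_add_neg]
    rw [this]
    apply hasProdLocallyUniformlyOn_of_forall_compact isOpen_univ
    intro K _ hcK
    obtain ⟨R, hR⟩ := hcK.isBounded.exists_norm_le
    refine ((summable_geometric_of_lt_one (norm_nonneg _) hp).mul_right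
      R).hasProdUniformlyOn_nat_one_add hcK (.of_forall fun n x hx ↦ ?_) (fun _ ↦ by fun_prop)
    simpa using mul_le_mul_of_nonneg_left (hR x hx) (by positivity)
  rw [← differentiableOn_univ]
  exact key.differentiableOn
    (.of_forall fun _ ↦ by simpa [Finset.prod_fn] using
      DifferentiableOn.finsetProd (fun _ _ ↦ by fun_prop)) isOpen_univ

/-- The product form of the theta function,
`∏_{n ≥ 0} (1 - p^n u) * ∏_{n ≥ 1} (1 - p^n u⁻¹)` with `p = exp(2πiτ)`, `u = exp(2πiz)`. -/
noncomputable def thetaProd (τ z : ℂ) : ℂ :=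
  qProd (cexp (2 * π * I * τ)) (cexp (2 * π * I * z)) *
    qProd (cexp (2 * π * I * τ)) (cexp (2 * π * I * τ) * cexp (-(2 * π * I * z)))

/-! ### Theta functions of degree `N`: zeros, division, factorization -/

/-- An entire function of period `1` with multiplier `C exp(-2πiNz)` for `τ`. -/
structure IsTheta (τ : ℂ) (N : ℤ) (C : ℂ) (h : ℂ → ℂ) : Prop where
  differentiable : Differentiable ℂ h
  add_one : ∀ z, h (z + 1) = h z
  add_tau : ∀ z, h (z + τ) = C * cexp (-(2 * π * I * N * z)) * h z

lemma IsTheta.mul {τ : ℂ} {M N : ℤ} {C D : ℂ} {f g : ℂ → ℂ} (hf : IsTheta τ M C f)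
    (hg : IsTheta τ N D g) : IsTheta τ (M + N) (C * D) (fun z => f z * g z) where
  differentiable := hf.differentiable.mul hg.differentiable
  add_one z := by rw [hf.add_one, hg.add_one]
  add_tau z := by
    rw [hf.add_tau, hg.add_tau]
    have : cexp (-(2 * π * I * ((M + N : ℤ) : ℂ) * z)) =
        cexp (-(2 * π * I * M * z)) * cexp (-(2 * π * I * N * z)) := by
      rw [← Complex.exp_add]; congr 1; push_cast; ring
    rw [this]; ring

lemma IsTheta.one (τ : ℂ) : IsTheta τ 0 1 (fun _ => 1) where
  differentiable := differentiable_const _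
  add_one _ := rfl
  add_tau z := by simp

lemma IsTheta.prod {ι : Type*} {τ : ℂ} {d : ℤ} (s : Finset ι) {C : ι → ℂ} {f : ι → ℂ → ℂ}
    (hf : ∀ i ∈ s, IsTheta τ d (C i) (f i)) :
    IsTheta τ (s.card * d) (∏ i ∈ s, C i) (fun z => ∏ i ∈ s, f i z) := by
  classical
  induction s using Finset.induction_on with
  | empty => simpa using IsTheta.one τ
  | insert a s ha ih =>
    simp only [Finset.prod_insert ha, Finset.card_insert_of_notMem ha]
    have := (hf a (by simp)).mul (ih fun i hi => hf i (by simp [hi]))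
    convert this using 1
    push_cast; ring

lemma IsTheta.apply_add_lattice_eq_zero {τ : ℂ} {N : ℤ} {C : ℂ} {h : ℂ → ℂ}
    (hh : IsTheta τ N C h) (hC : C ≠ 0) {w : ℂ} (hw : h w = 0) (m n : ℤ) :
    h (w + m + n * τ) = 0 := by
  have p1 : Function.Periodic (fun z => h z = 0) 1 := fun z => by simp only [hh.add_one]
  have p2 : Function.Periodic (fun z => h z = 0) τ := fun z => by
    simp [hh.add_tau, hC, Complex.exp_ne_zero]
  have e1 := p1.int_mul m w
  have e2 := p2.int_mul n (w + m * 1)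
  rw [e1] at e2
  simpa [hw] using e2

lemma norm_exp_two_pi_I_mul_lt_one {τ : ℂ} (hτ : 0 < τ.im) : ‖cexp (2 * π * I * τ)‖ < 1 := by
  rw [Complex.norm_exp]
  have : (2 * π * I * τ).re = -(2 * π * τ.im) := by simp
  rw [this, Real.exp_lt_one_iff]
  have := Real.pi_pos
  simp only [Left.neg_neg_iff]
  positivity

section
variable {τ : ℂ} (hτ : 0 < τ.im)
include hτ

lemma isTheta_thetaProd : IsTheta τ 1 (-1) (thetaProd τ) where
  differentiable := by
    have := differentiable_qProd (norm_exp_two_pi_I_mul_lt_one hτ)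
    unfold thetaProd
    fun_prop
  add_one z := by
    have e1 : cexp (2 * π * I * (z + 1)) = cexp (2 * π * I * z) := by
      rw [mul_add, Complex.exp_add]; simp
    simp only [thetaProd, Complex.exp_neg, e1]
  add_tau z := by
    have hp := norm_exp_two_pi_I_mul_lt_one hτ
    have hu : cexp (2 * π * I * z) ≠ 0 := Complex.exp_ne_zero _
    have hp0 : cexp (2 * π * I * τ) ≠ 0 := Complex.exp_ne_zero _
    have e1 : cexp (2 * π * I * (z + τ)) = cexp (2 * π * I * τ) * cexp (2 * π * I * z) := by
      rw [mul_add, Complex.exp_add, mul_comm]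
    simp only [thetaProd, Complex.exp_neg, e1, Int.cast_one, mul_one]
    generalize cexp (2 * π * I * z) = u at *
    generalize cexp (2 * π * I * τ) = p at *
    -- Replacing `u` by `pu` removes the factor `1 - u` from the first product and adds `1 - u⁻¹` to
    -- the second; their ratio gives the multiplier `-u⁻¹`.
    have e2 : p * (p * u)⁻¹ = u⁻¹ := by field_simp
    rw [e2, qProd_eq hp u, qProd_eq hp u⁻¹]
    field_simp
    ring

lemma thetaProd_eq_zero_iff {z : ℂ} : thetaProd τ z = 0 ↔ ∃ m n : ℤ, z = m + n * τ := by
  have hp := norm_exp_two_pi_I_mul_lt_one hτ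
  constructor
  · intro h
    rcases mul_eq_zero.mp h with h | h
    · obtain ⟨n, hn⟩ := exists_of_qProd_eq_zero hp h
      rw [← Complex.exp_nat_mul, ← Complex.exp_add, Complex.exp_eq_one_iff] at hn
      obtain ⟨m, hm⟩ := hn
      refine ⟨m, -n, ?_⟩
      have : (2 * π * I) * z = (2 * π * I) * (m + (-n : ℤ) * τ) := by
        push_cast; linear_combination hm
      exact mul_left_cancel₀ two_pi_I_ne_zero this
    · obtain ⟨n, hn⟩ := exists_of_qProd_eq_zero hp h
      rw [← Complex.exp_nat_mul, ← Complex.exp_add, ← Complex.exp_add,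
        Complex.exp_eq_one_iff] at hn
      obtain ⟨m, hm⟩ := hn
      refine ⟨-m, n + 1, ?_⟩
      have : (2 * π * I) * z = (2 * π * I) * ((-m : ℤ) + (n + 1 : ℤ) * τ) := by
        push_cast; linear_combination -hm
      exact mul_left_cancel₀ two_pi_I_ne_zero this
  · rintro ⟨m, n, rfl⟩
    have h0 : thetaProd τ 0 = 0 := by
      rw [thetaProd, mul_zero, Complex.exp_zero, qProd_eq hp 1]
      simp
    simpa using (isTheta_thetaProd hτ).apply_add_lattice_eq_zero (by simp) h0 m n

/-- Only the factor `1 - exp(2πiz)` vanishes at `0`, and it does so simply; the remaining factors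
are `1 - p^(n+1)` there, nonzero because `‖p‖ < 1`. -/
lemma deriv_thetaProd_zero_ne_zero : deriv (thetaProd τ) 0 ≠ 0 := by
  have hp := norm_exp_two_pi_I_mul_lt_one hτ
  set p := cexp (2 * π * I * τ) with hpdef
  set G : ℂ → ℂ := fun z => qProd p (p * cexp (2 * π * I * z)) *
    qProd p (p * cexp (-(2 * π * I * z))) with hG
  have dG : Differentiable ℂ G := by
    have := differentiable_qProd hp
    fun_prop
  have e : thetaProd τ = fun z => (1 - cexp (2 * π * I * z)) * G z := by
    ext z
    rw [thetaProd, qProd_eq hp (cexp (2 * π * I * z)), hG]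
    simp only [hpdef, mul_assoc]
  have hd : HasDerivAt (fun z : ℂ => 1 - cexp (2 * π * I * z))
      (-(cexp (2 * π * I * 0) * (2 * π * I * 1))) 0 :=
    (((hasDerivAt_id (0 : ℂ)).const_mul (2 * π * I)).cexp).const_sub 1
  rw [e, (hd.fun_mul (dG 0).hasDerivAt).deriv]
  have hq : qProd p p ≠ 0 := by
    intro h
    obtain ⟨n, hn⟩ := exists_of_qProd_eq_zero hp h
    rw [← pow_succ] at hn
    have := congrArg norm hn
    rw [norm_pow, norm_one] at this
    exact (pow_lt_one₀ (norm_nonneg _) hp (Nat.succ_ne_zero n)).ne this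
  have : G 0 ≠ 0 := by simpa [hG] using hq
  simpa using this

/-- Being a simple zero is invariant under both lattice translations, since the multiplier never
vanishes, so the zero at the origin decides. -/
lemma deriv_thetaProd_ne_zero {z : ℂ} (hz : thetaProd τ z = 0) : deriv (thetaProd τ) z ≠ 0 := by
  have hS := isTheta_thetaProd hτ
  have p1 : Function.Periodic (fun z => thetaProd τ z = 0 ∧ deriv (thetaProd τ) z ≠ 0) 1 := by
    intro z
    simp only [hS.add_one, ← deriv_comp_add_const]
  have p2 : Function.Periodic (fun z => thetaProd τ z = 0 ∧ deriv (thetaProd τ) z ≠ 0) τ := by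
    intro z
    simp only [← deriv_comp_add_const, hS.add_tau]
    have h0 : thetaProd τ z = 0 → deriv (fun z => -1 * cexp (-(2 * π * I * (1 : ℤ) * z)) *
        thetaProd τ z) z = -1 * cexp (-(2 * π * I * (1 : ℤ) * z)) * deriv (thetaProd τ) z := by
      intro h
      have d1 : DifferentiableAt ℂ (fun z => -1 * cexp (-(2 * π * I * (1 : ℤ) * z))) z := by
        fun_prop
      have := deriv_mul d1 (hS.differentiable z)
      rw [h, mul_zero, zero_add] at this
      exact this
    apply propext
    constructor
    · rintro ⟨h1, h2⟩
      have h1' : thetaProd τ z = 0 := by simpa [Complex.exp_ne_zero] using h1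
      rw [h0 h1'] at h2
      exact ⟨h1', right_ne_zero_of_mul h2⟩
    · rintro ⟨h1, h2⟩
      rw [h0 h1, h1]
      exact ⟨by simp, mul_ne_zero (by simp [Complex.exp_ne_zero]) h2⟩
  obtain ⟨m, n, rfl⟩ := (thetaProd_eq_zero_iff hτ).mp hz
  have e1 := p1.int_mul m 0
  have e2 := p2.int_mul n (0 + m * 1)
  rw [e1] at e2
  have h0 : thetaProd τ 0 = 0 := (thetaProd_eq_zero_iff hτ).mpr ⟨0, 0, by simp⟩
  have := e2.mpr ⟨h0, deriv_thetaProd_zero_ne_zero hτ⟩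
  simpa using this.2

lemma thetaProd_half_ne_zero : thetaProd τ (1 / 2) ≠ 0 := by
  rw [Ne, thetaProd_eq_zero_iff hτ]
  rintro ⟨m, n, h⟩
  have him := congrArg Complex.im h
  have hre := congrArg Complex.re h
  simp at him hre
  rcases him with rfl | h
  · simp at hre
    have : (1 : ℝ) = 2 * m := by linarith
    have : (1 : ℤ) = 2 * m := by exact_mod_cast this
    omega
  · exact hτ.ne' h

lemma isTheta_thetaProd_sub (w : ℂ) :
    IsTheta τ 1 (-cexp (2 * π * I * w)) (fun z => thetaProd τ (z - w)) where
  differentiable := (isTheta_thetaProd hτ).differentiable.comp (differentiable_id.sub_const w)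
  add_one z := by
    rw [add_sub_right_comm, (isTheta_thetaProd hτ).add_one]
  add_tau z := by
    rw [add_sub_right_comm, (isTheta_thetaProd hτ).add_tau]
    have : cexp (-(2 * π * I * (1 : ℤ) * (z - w))) =
      cexp (2 * π * I * w) * cexp (-(2 * π * I * (1 : ℤ) * z)) := by
      rw [← Complex.exp_add]; congr 1; push_cast; ring
    rw [this]; ring

/-- Quasi-periodicity spreads the zero `w` over `w + ℤ + ℤτ`, which is the zero set of the divisor,
and those zeros are simple. The multiplier of the quotient is the quotient of the multipliers. -/
lemma IsTheta.exists_div_thetaProd {N : ℤ} {C : ℂ} {h : ℂ → ℂ} (hh : IsTheta τ N C h)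
    (hC : C ≠ 0) {w : ℂ} (hw : h w = 0) :
    ∃ f, IsTheta τ (N - 1) (C * -cexp (-(2 * π * I * w))) f ∧
      ∀ z, h z = f z * thetaProd τ (z - w) := by
  have hS := isTheta_thetaProd_sub hτ w
  obtain ⟨f, hf, hfe⟩ := exists_entire_quotient hh.differentiable hS.differentiable (by
    intro z hz
    refine ⟨?_, ?_⟩
    · obtain ⟨m, n, hmn⟩ := (thetaProd_eq_zero_iff hτ).mp hz
      have : z = w + m + n * τ := by linear_combination hmn
      rw [this]
      exact hh.apply_add_lattice_eq_zero hC hw m n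
    · rw [deriv_comp_sub_const]
      exact deriv_thetaProd_ne_zero hτ hz)
  have hne : thetaProd τ (w + 1 / 2 - w) ≠ 0 := by
    simpa using thetaProd_half_ne_zero hτ
  have hfc := hf.continuous
  refine ⟨f, ⟨hf, ?_, ?_⟩, hfe⟩
  · refine eq_of_mul_eq_mul (by fun_prop) hfc hS.differentiable hne fun z => ?_
    rw [← hfe z, ← hh.add_one z, hfe (z + 1), hS.add_one]
  · refine eq_of_mul_eq_mul (by fun_prop) (by fun_prop) hS.differentiable hne fun z => ?_
    have h1 := hh.add_tau z
    rw [hfe (z + τ), hfe z, hS.add_tau] at h1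
    have e1 : cexp (-(2 * π * I * ((N - 1 : ℤ) : ℂ) * z)) =
        cexp (-(2 * π * I * N * z)) * cexp (2 * π * I * z) := by
      rw [← Complex.exp_add]; congr 1; push_cast; ring
    have e2 : cexp (-(2 * π * I * (1 : ℤ) * z)) = (cexp (2 * π * I * z))⁻¹ := by
      rw [← Complex.exp_neg]; simp
    have hz0 := Complex.exp_ne_zero (2 * π * I * z)
    have hw0 := Complex.exp_ne_zero (2 * π * I * w)
    rw [e2] at h1
    rw [e1, Complex.exp_neg (2 * π * I * w)]
    generalize thetaProd τ (z - w) = s at *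
    field_simp at h1 ⊢
    linear_combination -h1

omit hτ in
lemma exists_exp_two_pi_I_mul_eq {c : ℂ} (hc : c ≠ 0) : ∃ b : ℂ, cexp (2 * π * I * b) = c := by
  refine ⟨Complex.log c / (2 * π * I), ?_⟩
  rw [mul_div_cancel₀ _ two_pi_I_ne_zero, Complex.exp_log hc]

/-- Multiplying by a theta factor whose zero `b` is chosen to cancel the multiplier gives a doubly
periodic entire function, hence a constant; it vanishes at `b`. -/
lemma IsTheta.eq_zero_of_neg_one {C : ℂ} {h : ℂ → ℂ} (hh : IsTheta τ (-1) C h) (z : ℂ) :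
    h z = 0 := by
  rcases eq_or_ne C 0 with rfl | hC
  · simpa using hh.add_tau (z - τ)
  obtain ⟨b, hb⟩ := exists_exp_two_pi_I_mul_eq (c := -C⁻¹) (by simpa using hC)
  have hS := isTheta_thetaProd_sub hτ b
  have hg := hh.mul hS
  have hconst := apply_eq_apply_zero_of_doubly_periodic hτ hg.differentiable hg.add_one (by
    intro z
    rw [hg.add_tau, hb]
    simp [hC])
  have h0 : thetaProd τ (b - b) = 0 := (thetaProd_eq_zero_iff hτ).mpr ⟨0, 0, by simp⟩
  have hb0 := hconst b
  simp only [h0, mul_zero] at hb0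
  refine eq_of_mul_eq_mul (g := fun _ => 0) hh.differentiable.continuous continuous_const
    hS.differentiable (w := b + 1 / 2) (by simpa using thetaProd_half_ne_zero hτ) (fun z => ?_) z
  rw [hconst z, ← hb0, zero_mul]

lemma IsTheta.eq_zero_of_apply_eq_zero {C : ℂ} {h : ℂ → ℂ} (hh : IsTheta τ 0 C h) {w : ℂ}
    (hw : h w = 0) (z : ℂ) : h z = 0 := by
  rcases eq_or_ne C 0 with rfl | hC
  · simpa using hh.add_tau (z - τ)
  obtain ⟨f, hf, hfe⟩ := hh.exists_div_thetaProd hτ hC hw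
  rw [hfe, hf.eq_zero_of_neg_one hτ, zero_mul]

omit hτ in
lemma IsTheta.const_ne_zero {N : ℤ} {C : ℂ} {h : ℂ → ℂ} (hh : IsTheta τ N C h) {w : ℂ}
    (hw : h w ≠ 0) : C ≠ 0 := by
  rintro rfl
  apply hw
  simpa using hh.add_tau (w - τ)

/-- The logarithmic derivative `L` is entire and changes by `0` and `-2πiN` under the two
translations. So `L'` is doubly periodic, hence constant; period `1` makes the affine function `L`
constant, and then `N = 0`. Consequently a theta function of nonzero degree has a zero. -/
lemma IsTheta.exists_deriv_eq_mul {N : ℤ} {C : ℂ} {h : ℂ → ℂ} (hh : IsTheta τ N C h)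
    (hne : ∀ z, h z ≠ 0) : N = 0 ∧ ∃ α : ℂ, ∀ z, deriv h z = α * h z := by
  have hC : C ≠ 0 := hh.const_ne_zero (hne 0)
  set L : ℂ → ℂ := fun z => deriv h z / h z with hL
  have dL : Differentiable ℂ L := hh.differentiable.deriv.div hh.differentiable hne
  have L1 : ∀ z, L (z + 1) = L z := by
    intro z
    simp only [hL, ← deriv_comp_add_const, hh.add_one]
  have L2 : ∀ z, L (z + τ) = L z + -(2 * π * I * N) := by
    intro z
    simp only [hL, ← deriv_comp_add_const, hh.add_tau]
    have d1 : HasDerivAt (fun z => C * cexp (-(2 * π * I * N * z)))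
        (C * (cexp (-(2 * π * I * N * z)) * -(2 * π * I * N * 1))) z :=
      ((((hasDerivAt_id z).const_mul (2 * π * I * N)).neg).cexp).const_mul C
    rw [(d1.fun_mul (hh.differentiable z).hasDerivAt).deriv]
    have := hne z
    have := Complex.exp_ne_zero (-(2 * π * I * N * z))
    field_simp
    ring
  have dL' : ∀ z, deriv L z = deriv L 0 :=
    apply_eq_apply_zero_of_doubly_periodic hτ dL.deriv
      (fun z => by rw [← deriv_comp_add_const]; simp only [L1])
      (fun z => by rw [← deriv_comp_add_const]; simp only [L2, deriv_add_const])
  have hlin : ∀ z, L z - deriv L 0 * z = L 0 - deriv L 0 * 0 := by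
    intro z
    refine is_const_of_deriv_eq_zero (f := fun z => L z - deriv L 0 * z) (by fun_prop) ?_ z 0
    intro z
    have := ((dL z).hasDerivAt.fun_sub ((hasDerivAt_id z).const_mul (deriv L 0))).deriv
    simp only [id] at this
    rw [this, dL' z]
    ring
  have hA : deriv L 0 = 0 := by
    have h1 := hlin 1
    have h2 := L1 0
    rw [zero_add] at h2
    linear_combination h2 - h1
  have hLc : ∀ z, L z = L 0 := by
    intro z
    have := hlin z
    rw [hA] at this
    linear_combination this
  refine ⟨?_, L 0, fun z => ?_⟩
  · have h2 := L2 0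
    rw [hLc] at h2
    have : 2 * π * I * (N : ℂ) = 0 := by linear_combination h2
    have := (mul_eq_zero.mp this).resolve_left two_pi_I_ne_zero
    exact_mod_cast this
  · rw [← hLc z, hL, div_mul_cancel₀ _ (hne z)]

lemma IsTheta.exists_eq_exp {C : ℂ} {h : ℂ → ℂ} (hh : IsTheta τ 0 C h) {w : ℂ} (hw : h w ≠ 0) :
    ∃ (c : ℂ) (m : ℤ), C = cexp (2 * π * I * m * τ) ∧ ∀ z, h z = c * cexp (2 * π * I * m * z) := by
  have hne : ∀ z, h z ≠ 0 := fun z hz => hw (hh.eq_zero_of_apply_eq_zero hτ hz w)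
  obtain ⟨-, α, hα⟩ := hh.exists_deriv_eq_mul hτ hne
  have hform : ∀ z, h z = h 0 * cexp (α * z) := by
    intro z
    have := is_const_of_deriv_eq_zero (f := fun z => h z * cexp (-(α * z)))
      (by have := hh.differentiable; fun_prop) (fun z => by
        have d1 : HasDerivAt (fun z => cexp (-(α * z))) (cexp (-(α * z)) * -(α * 1)) z :=
          (((hasDerivAt_id z).const_mul α).neg).cexp
        rw [((hh.differentiable z).hasDerivAt.fun_mul d1).deriv, hα]
        ring) z 0
    simp only [mul_zero, neg_zero, Complex.exp_zero, mul_one] at this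
    rw [← this, mul_assoc, ← Complex.exp_add]
    simp
  have h1 := hh.add_one 0
  rw [zero_add, hform 1, mul_one, mul_eq_left₀ (hne 0), Complex.exp_eq_one_iff] at h1
  obtain ⟨m, hm⟩ := h1
  have hα' : α = 2 * π * I * m := by rw [hm]; ring
  refine ⟨h 0, m, ?_, fun z => by rw [hform z, hα']⟩
  have h2 := hh.add_tau 0
  rw [zero_add, hform τ, hα'] at h2
  simp only [mul_zero, neg_zero, Complex.exp_zero, mul_one] at h2
  refine mul_right_cancel₀ (hne 0) ?_
  rw [← h2, mul_comm]

/-- An entire theta function of degree `N` is a product of `N` shifted theta functions. -/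
lemma IsTheta.exists_eq_prod (N : ℕ) : ∀ {C : ℂ} {h : ℂ → ℂ} (_ : IsTheta τ N C h) {w : ℂ}
    (_ : h w ≠ 0), ∃ (c : ℂ) (m : ℤ) (a : Fin N → ℂ),
      C = cexp (2 * π * I * m * τ) * ∏ i, -cexp (2 * π * I * a i) ∧
      ∀ z, h z = c * cexp (2 * π * I * m * z) * ∏ i, thetaProd τ (z - a i) := by
  induction N with
  | zero =>
    intro C h hh w hw
    obtain ⟨c, m, h1, h2⟩ := IsTheta.exists_eq_exp hτ (by simpa using hh) hw
    exact ⟨c, m, Fin.elim0, by simpa using h1, by simpa using h2⟩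
  | succ N ih =>
    intro C h hh w hw
    have hC := hh.const_ne_zero hw
    obtain ⟨b, hb⟩ : ∃ b, h b = 0 := by
      by_contra! hne
      have := (hh.exists_deriv_eq_mul hτ hne).1
      omega
    obtain ⟨f, hf, hfe⟩ := hh.exists_div_thetaProd hτ hC hb
    obtain ⟨c, m, a, h1, h2⟩ := ih (w := w) (by simpa using hf) (by
      intro h0
      rw [hfe, h0, zero_mul] at hw
      exact hw rfl)
    refine ⟨c, m, Fin.cons b a, ?_, fun z => ?_⟩
    · rw [Fin.prod_univ_succ]
      simp only [Fin.cons_zero, Fin.cons_succ]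
      rw [mul_left_comm, ← h1, Complex.exp_neg]
      have := Complex.exp_ne_zero (2 * π * I * b)
      field_simp
    · rw [Fin.prod_univ_succ, hfe, h2]
      simp only [Fin.cons_zero, Fin.cons_succ]
      ring

end

/-! ### Dimension of the space of theta functions -/

/-- The space of entire theta functions of degree `N` with multiplier constant `C`. -/
def thetaSpace (τ : ℂ) (N : ℤ) (C : ℂ) : Submodule ℂ (ℂ → ℂ) where
  carrier := {h | IsTheta τ N C h}
  zero_mem' := ⟨differentiable_const 0, fun _ => rfl, fun _ => by simp⟩
  add_mem' {f g} hf hg := ⟨hf.differentiable.add hg.differentiable,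
    fun z => by simp [hf.add_one, hg.add_one],
    fun z => by simp [hf.add_tau, hg.add_tau, mul_add]⟩
  smul_mem' c f hf := ⟨hf.differentiable.const_smul c,
    fun z => by simp [hf.add_one],
    fun z => by simp [hf.add_tau, mul_left_comm]⟩

section
variable {τ : ℂ} (hτ : 0 < τ.im)
include hτ

lemma IsTheta.exists_div_prod {ι : Type*} {N : ℤ} {C : ℂ} {h : ℂ → ℂ} (hh : IsTheta τ N C h)
    (hC : C ≠ 0) (x : ι → ℂ) (hx : ∀ i j, i ≠ j → thetaProd τ (x i - x j) ≠ 0) (s : Finset ι)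
    (hs : ∀ i ∈ s, h (x i) = 0) :
    ∃ f, IsTheta τ (N - s.card) (C * ∏ i ∈ s, -cexp (-(2 * π * I * x i))) f ∧
      ∀ z, h z = f z * ∏ i ∈ s, thetaProd τ (z - x i) := by
  classical
  induction s using Finset.induction_on with
  | empty => exact ⟨h, by simpa using hh, by simp⟩
  | insert a s ha ih =>
    obtain ⟨f, hf, hfe⟩ := ih fun i hi => hs i (by simp [hi])
    have hfa : f (x a) = 0 := by
      have h0 := hs a (by simp)
      rw [hfe] at h0
      refine (mul_eq_zero.mp h0).resolve_right (Finset.prod_ne_zero_iff.mpr fun i hi => ?_)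
      exact hx a i fun h => ha (h ▸ hi)
    obtain ⟨g, hg, hge⟩ := hf.exists_div_thetaProd hτ (mul_ne_zero hC
      (Finset.prod_ne_zero_iff.mpr fun i _ => by simp [Complex.exp_ne_zero])) hfa
    refine ⟨g, ?_, fun z => ?_⟩
    · rw [Finset.prod_insert ha, Finset.card_insert_of_notMem ha]
      convert hg using 1
      · push_cast; ring
      · ring
    · rw [Finset.prod_insert ha, hfe, hge]; ring

/-- Evaluation at `N` points in general position identifies the theta functions of degree `N`
with `ℂ^N`. -/
lemma bijective_eval {N : ℕ} {C : ℂ} (hC : C ≠ 0) (x : Fin N → ℂ)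
    (hx : ∀ i j, i ≠ j → thetaProd τ (x i - x j) ≠ 0)
    (hprod : C * ∏ i, -cexp (-(2 * π * I * x i)) = -1) :
    Function.Bijective
      ((LinearMap.funLeft ℂ ℂ x).comp (thetaSpace τ N C).subtype) := by
  constructor
  · rw [← LinearMap.ker_eq_bot, LinearMap.ker_eq_bot']
    rintro ⟨h, hh⟩ h0
    obtain ⟨f, hf, hfe⟩ := IsTheta.exists_div_prod hτ (N := N) hh hC x hx Finset.univ
      fun i _ => congrFun h0 i
    rw [hprod, Finset.card_fin, sub_self] at hf
    ext z
    by_contra hz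
    have hfz : f z ≠ 0 := by
      intro h1
      apply hz
      change h z = 0
      rw [hfe, h1, zero_mul]
    obtain ⟨-, m, hm, -⟩ := hf.exists_eq_exp hτ hfz
    -- The quotient by all `N` factors has degree `0` and multiplier `-1`; a nonzero one would have
    -- multiplier `exp(2πimτ)`, forcing `1/2 ∈ ℤ + ℤτ`.
    have h1 : cexp (π * I) = cexp (2 * π * I * m * τ) := by rw [Complex.exp_pi_mul_I, hm]
    obtain ⟨n, hn⟩ := Complex.exp_eq_exp_iff_exists_int.mp h1
    have h2 : (1 / 2 : ℂ) = n + m * τ := by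
      refine mul_left_cancel₀ two_pi_I_ne_zero ?_
      linear_combination hn
    exact thetaProd_half_ne_zero hτ ((thetaProd_eq_zero_iff hτ).mpr ⟨n, m, h2⟩)
  · classical
    -- Lagrange interpolation: `b j` vanishes at every `x i` with `i ≠ j`. Moving the zero `x j` by
    -- `1/2` keeps `b j (x j)` nonzero and supplies the sign that makes the multiplier constant
    -- equal to `C`.
    set b : Fin N → ℂ → ℂ := fun j z => thetaProd τ (z - (x j + 1 / 2)) *
      ∏ i ∈ Finset.univ.erase j, thetaProd τ (z - x i) with hb
    have hbT : ∀ j, b j ∈ thetaSpace τ N C := by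
      intro j
      have h1 := (isTheta_thetaProd_sub hτ (x j + 1 / 2)).mul
        (IsTheta.prod (τ := τ) (Finset.univ.erase j) fun i _ => isTheta_thetaProd_sub hτ (x i))
      have hN : (1 + ((Finset.univ.erase j).card : ℤ) * 1) = N := by
        have := Finset.card_erase_add_one (Finset.mem_univ j)
        rw [Finset.card_fin] at this
        omega
      have hCe : -cexp (2 * π * I * (x j + 1 / 2)) *
          ∏ i ∈ Finset.univ.erase j, -cexp (2 * π * I * x i) = C := by
        have e1 : -cexp (2 * π * I * (x j + 1 / 2)) = - -cexp (2 * π * I * x j) := by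
          have : 2 * π * I * (x j + 1 / 2) = 2 * π * I * x j + π * I := by ring
          rw [this, Complex.exp_add, Complex.exp_pi_mul_I]
          ring
        rw [e1, neg_mul, Finset.mul_prod_erase Finset.univ (fun i => -cexp (2 * π * I * x i))
          (Finset.mem_univ j)]
        have e2 : (∏ i, -cexp (2 * π * I * x i)) * ∏ i, -cexp (-(2 * π * I * x i)) = 1 := by
          rw [← Finset.prod_mul_distrib]
          refine Finset.prod_eq_one fun i _ => ?_
          rw [neg_mul_neg, ← Complex.exp_add, add_neg_cancel, Complex.exp_zero]
        linear_combination (-∏ i, -cexp (2 * π * I * x i)) * hprod + C * e2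
      rw [hN, hCe] at h1
      exact h1
    have hbne : ∀ j, b j (x j) ≠ 0 := by
      intro j
      refine mul_ne_zero ?_ (Finset.prod_ne_zero_iff.mpr fun i hi => ?_)
      · rw [sub_add_cancel_left, Ne, thetaProd_eq_zero_iff hτ]
        rintro ⟨m, n, hmn⟩
        exact thetaProd_half_ne_zero hτ ((thetaProd_eq_zero_iff hτ).mpr
          ⟨-m, -n, by push_cast; linear_combination -hmn⟩)
      · exact hx j i (Finset.ne_of_mem_erase hi).symm
    have hb0 : ∀ i j, i ≠ j → b j (x i) = 0 := by
      intro i j hij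
      have h0 : thetaProd τ (x i - x i) = 0 := (thetaProd_eq_zero_iff hτ).mpr ⟨0, 0, by simp⟩
      simp only [hb]
      rw [Finset.prod_eq_zero (Finset.mem_erase.mpr ⟨hij, Finset.mem_univ i⟩) h0, mul_zero]
    intro v
    refine ⟨∑ j, (v j / b j (x j)) • ⟨b j, hbT j⟩, ?_⟩
    ext i
    simp only [LinearMap.comp_apply, Submodule.subtype_apply, LinearMap.funLeft_apply,
      Submodule.coe_sum, Submodule.coe_smul, Finset.sum_apply, Pi.smul_apply, smul_eq_mul]
    rw [Finset.sum_eq_single i (fun j _ hji => by rw [hb0 i j hji.symm, mul_zero]) (by simp),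
      div_mul_cancel₀ _ (hbne i)]

/-- The space of theta functions of degree `N ≥ 1` has dimension `N`. -/
lemma nonempty_thetaSpace_equiv {N : ℕ} (hN : 1 ≤ N) {C : ℂ} (hC : C ≠ 0) :
    Nonempty (thetaSpace τ N C ≃ₗ[ℂ] (Fin N → ℂ)) := by
  have hN0 : (N : ℂ) ≠ 0 := by exact_mod_cast (by omega : N ≠ 0)
  set K : ℂ := ∏ i : Fin N, -cexp (-(2 * π * I * ((i : ℕ) / N : ℂ))) with hK
  have hK0 : K ≠ 0 := Finset.prod_ne_zero_iff.mpr fun i _ => by simp [Complex.exp_ne_zero]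
  obtain ⟨w, hw⟩ := exists_exp_two_pi_I_mul_eq (c := -(C * K)) (by simp [hC, hK0])
  -- The points `(w + i)/N` are inequivalent modulo the lattice. Their `N` shifts `w/N` contribute
  -- `exp(-2πiw)` to the product, and `w` was chosen to make it `-1`.
  refine ⟨LinearEquiv.ofBijective _ (bijective_eval hτ hC
    (fun i : Fin N => w / N + ((i : ℕ) / N : ℂ)) ?_ ?_)⟩
  · intro i j hij
    rw [Ne, thetaProd_eq_zero_iff hτ]
    rintro ⟨m, n, h⟩
    have h' : ((i : ℕ) : ℂ) - ((j : ℕ) : ℂ) = N * m + N * n * τ := by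
      field_simp at h
      linear_combination h
    have him := congrArg Complex.im h'
    have hre := congrArg Complex.re h'
    simp [hτ.ne'] at him hre
    obtain rfl := him.resolve_left (by omega)
    have : ((i : ℕ) : ℤ) - ((j : ℕ) : ℤ) = N * m := by
      have : (((i : ℕ) : ℤ) : ℝ) - (((j : ℕ) : ℤ) : ℝ) = ((N : ℤ) : ℝ) * m := by simpa using hre
      exact_mod_cast this
    have hi := i.isLt
    have hj := j.isLt
    have hne : (i : ℕ) ≠ j := fun h => hij (Fin.ext h)
    have h0 : (N : ℤ) ∣ (i : ℕ) - (j : ℕ) := ⟨m, this⟩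
    have := Int.eq_zero_of_abs_lt_dvd h0 (by rw [abs_lt]; omega)
    omega
  · have e : ∏ i : Fin N, -cexp (-(2 * π * I * (w / N + ((i : ℕ) / N : ℂ)))) =
        (cexp (2 * π * I * w))⁻¹ * K := by
      have e1 : ∀ i : Fin N, -cexp (-(2 * π * I * (w / N + ((i : ℕ) / N : ℂ)))) =
          cexp (-(2 * π * I * w) / N) * -cexp (-(2 * π * I * ((i : ℕ) / N : ℂ))) := by
        intro i
        rw [mul_neg, ← Complex.exp_add]
        congr 2
        ring
      rw [Finset.prod_congr rfl fun i _ => e1 i, Finset.prod_mul_distrib, Finset.prod_const,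
        Finset.card_fin, ← Complex.exp_nat_mul, mul_div_cancel₀ _ hN0, Complex.exp_neg]
    rw [e, hw]
    field_simp

end

/-! ### Comparison of the theta series with the product -/

/-- The zeroth Fourier coefficient on `[0, 1]` is `1`, so the series cannot vanish identically. -/
lemma exists_jacobiTheta₂_ne_zero {τ : ℂ} (hτ : 0 < τ.im) : ∃ x : ℂ, jacobiTheta₂ x τ ≠ 0 := by
  by_contra! h0
  let f : ℤ → C(ℝ, ℂ) := fun n => ⟨fun x => jacobiTheta₂_term n x τ, by
    unfold jacobiTheta₂_term; fun_prop⟩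
  have hs := (summable_jacobiTheta₂_term_iff 0 τ).mpr hτ
  have hsum : Summable fun n => ‖(f n).restrict
      (⟨Set.uIcc (0 : ℝ) 1, isCompact_uIcc⟩ : TopologicalSpace.Compacts ℝ)‖ := by
    refine Summable.of_nonneg_of_le (fun _ => norm_nonneg _) (fun n => ?_) hs.norm
    rw [ContinuousMap.norm_le _ (norm_nonneg _)]
    rintro ⟨x, _⟩
    simp [f, norm_jacobiTheta₂_term]
  have key := intervalIntegral.hasSum_intervalIntegral_of_summable_norm hsum
  have hz : ∀ x : ℝ, ∑' n, f n x = 0 := fun x => h0 x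
  simp only [hz, intervalIntegral.integral_zero] at key
  have hint : ∀ n : ℤ, n ≠ 0 → ∫ x in (0 : ℝ)..1, f n x = 0 := by
    intro n hn
    have hn' : 2 * π * I * n ≠ 0 := mul_ne_zero two_pi_I_ne_zero (by exact_mod_cast hn)
    have e : ∀ x : ℝ, f n x = cexp (2 * π * I * n * x) * cexp (π * I * n ^ 2 * τ) := by
      intro x
      simp [f, jacobiTheta₂_term, Complex.exp_add]
    simp only [e, intervalIntegral.integral_mul_const]
    rw [integral_exp_mul_complex hn']
    have : cexp (2 * π * I * n * (1 : ℝ)) = 1 := by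
      rw [Complex.exp_eq_one_iff]; exact ⟨n, by push_cast; ring⟩
    rw [this]
    simp
  have h1 := key.unique (hasSum_single 0 hint)
  have e0 : ∀ x : ℝ, f 0 x = 1 := by intro x; simp [f, jacobiTheta₂_term]
  simp [e0] at h1

lemma theta_eq_jacobiTheta₂ (τ z : ℂ) : theta τ z =
    I * cexp (π * I * τ / 4) * cexp (-(π * I * z)) * jacobiTheta₂ (z + (1 - τ) / 2) τ := by
  rw [theta, jacobiTheta₂, ← tsum_mul_left, ← tsum_mul_left]
  refine tsum_congr fun n => ?_
  have h1 : (-1 : ℂ) ^ n = cexp (π * I * n) := by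
    rw [← Complex.exp_pi_mul_I, ← Complex.exp_int_mul]
    congr 1; ring
  rw [h1, jacobiTheta₂_term, ← Complex.exp_add, ← Complex.exp_add,
    mul_assoc I (cexp _), ← Complex.exp_add, mul_assoc I (cexp _), ← Complex.exp_add]
  congr 2
  ring

/-- Evenness and period `1` equate the values at `(1 - τ)/2` and `(1 + τ)/2`, while translation by
`τ` gives the factor `-1`. -/
lemma jacobiTheta₂_one_sub_div_two (τ : ℂ) : jacobiTheta₂ ((1 - τ) / 2) τ = 0 := by
  have h1 := jacobiTheta₂_add_left' ((1 - τ) / 2) τ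
  have h2 : jacobiTheta₂ ((1 - τ) / 2 + τ) τ = jacobiTheta₂ ((1 - τ) / 2) τ := by
    rw [← jacobiTheta₂_neg_left, ← jacobiTheta₂_add_left]
    congr 1; ring
  have h3 : cexp (-π * I * (τ + 2 * ((1 - τ) / 2))) = -1 := by
    have : -π * I * (τ + 2 * ((1 - τ) / 2)) = -(π * I) := by ring
    rw [this, Complex.exp_neg, Complex.exp_pi_mul_I]; norm_num
  rw [h2, h3] at h1
  linear_combination h1 / 2

/-- The theta series equals its product form up to an elementary factor. -/
lemma exists_theta_eq_thetaProd {τ : ℂ} (hτ : 0 < τ.im) :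
    ∃ c : ℂ, c ≠ 0 ∧ ∀ z, theta τ z = c * cexp (-(π * I * z)) * thetaProd τ z := by
  set E : ℂ → ℂ := fun z => jacobiTheta₂ (z + (1 - τ) / 2) τ with hE
  have hET : IsTheta τ 1 (-1) E := by
    refine ⟨?_, fun z => ?_, fun z => ?_⟩
    · intro z
      exact (differentiableAt_jacobiTheta₂_fst (z + (1 - τ) / 2) hτ).comp z
        (differentiableAt_id.add_const _)
    · simp only [hE]
      rw [add_right_comm, jacobiTheta₂_add_left]
    · simp only [hE]
      rw [add_right_comm, jacobiTheta₂_add_left']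
      have : -π * I * (τ + 2 * (z + (1 - τ) / 2)) = -(π * I) + -(2 * π * I * (1 : ℤ) * z) := by
        push_cast; ring
      rw [this, Complex.exp_add, Complex.exp_neg (π * I), Complex.exp_pi_mul_I]
      norm_num
  obtain ⟨f, hf, hfe⟩ := hET.exists_div_thetaProd hτ (by simp) (w := 0)
    (by simp only [hE, zero_add]; exact jacobiTheta₂_one_sub_div_two τ)
  simp only [sub_zero] at hfe
  -- The quotient has degree `0` and multiplier `(-1)(-1) = 1`.
  have hconst := apply_eq_apply_zero_of_doubly_periodic hτ hf.differentiable hf.add_one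
    (by intro z; rw [hf.add_tau]; simp)
  have hf0 : f 0 ≠ 0 := by
    obtain ⟨x, hx⟩ := exists_jacobiTheta₂_ne_zero hτ
    intro h0
    apply hx
    have := hfe (x - (1 - τ) / 2)
    rw [hconst, h0, zero_mul] at this
    simpa [hE] using this
  refine ⟨I * cexp (π * I * τ / 4) * f 0, by simp [hf0, Complex.exp_ne_zero], fun z => ?_⟩
  rw [theta_eq_jacobiTheta₂]
  have := hfe z
  rw [hconst z] at this
  simp only [hE] at this
  rw [this]; ring

/-! ### Translation laws and the identification of `V_k(μ)` -/

section
variable {τ : ℂ} (hτ : 0 < τ.im)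
include hτ

lemma differentiable_theta : Differentiable ℂ (theta τ) := by
  obtain ⟨c, -, hc⟩ := exists_theta_eq_thetaProd hτ
  have := (isTheta_thetaProd hτ).differentiable
  rw [funext hc]
  fun_prop

lemma theta_half_ne_zero : theta τ (1 / 2) ≠ 0 := by
  obtain ⟨c, hc0, hc⟩ := exists_theta_eq_thetaProd hτ
  rw [hc]
  exact mul_ne_zero (mul_ne_zero hc0 (Complex.exp_ne_zero _)) (thetaProd_half_ne_zero hτ)

lemma theta_add_one (z : ℂ) : theta τ (z + 1) = -theta τ z := by
  obtain ⟨c, -, hc⟩ := exists_theta_eq_thetaProd hτ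
  rw [hc, hc, (isTheta_thetaProd hτ).add_one]
  have : -(π * I * (z + 1)) = -(π * I * z) + -(π * I) := by ring
  rw [this, Complex.exp_add, Complex.exp_neg (π * I), Complex.exp_pi_mul_I]
  ring

lemma theta_add_tau (z : ℂ) :
    theta τ (z + τ) = -cexp (-(π * I * τ) - 2 * π * I * z) * theta τ z := by
  obtain ⟨c, -, hc⟩ := exists_theta_eq_thetaProd hτ
  rw [hc, hc, (isTheta_thetaProd hτ).add_tau]
  have e1 : -(π * I * (z + τ)) = -(π * I * z) + -(π * I * τ) := by ring
  have e2 : -(π * I * τ) - 2 * π * I * z = -(π * I * τ) + -(2 * π * I * (1 : ℤ) * z) := by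
    push_cast; ring
  rw [e1, e2, Complex.exp_add, Complex.exp_add]
  ring

lemma exists_thetaProd_add_lattice (n M : ℤ) : ∃ d : ℂ, d ≠ 0 ∧
    ∀ z, thetaProd τ (z + n + M * τ) = d * cexp (-(2 * π * I * M * z)) * thetaProd τ z := by
  have hτ0 : τ ≠ 0 := by rintro rfl; simp at hτ
  -- Since `q (z + τ) - q z = 2πiz - πi`, the factor `exp(q)` makes `thetaProd` exactly
  -- `τ`-periodic, which handles all integers `M`, negative ones included, at once.
  set q : ℂ → ℂ := fun z => π * I * z ^ 2 / τ - π * I * z - π * I * z / τ with hq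
  have hper : Function.Periodic (fun z => thetaProd τ z * cexp (q z)) τ := by
    intro z
    simp only
    have e : cexp (q (z + τ)) = -cexp (2 * π * I * (1 : ℤ) * z) * cexp (q z) := by
      have : q (z + τ) = 2 * π * I * (1 : ℤ) * z + q z + -(π * I) := by
        simp only [hq]; field_simp; push_cast; ring
      rw [this, Complex.exp_add, Complex.exp_add, Complex.exp_neg, Complex.exp_pi_mul_I]
      norm_num
    rw [(isTheta_thetaProd hτ).add_tau, e, Complex.exp_neg]
    have := Complex.exp_ne_zero (2 * π * I * (1 : ℤ) * z)
    field_simp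
  have hper1 : Function.Periodic (thetaProd τ) 1 := (isTheta_thetaProd hτ).add_one
  refine ⟨cexp (-(π * I * (M ^ 2 * τ - M * τ - M + 2 * n * M))) *
    cexp (2 * π * I * (n * M : ℤ)), by simp [Complex.exp_ne_zero], fun z => ?_⟩
  have h1 := hper1.int_mul n z
  have h2 := hper.int_mul M (z + n)
  rw [mul_one] at h1
  simp only [h1] at h2
  have e : cexp (-(2 * π * I * M * z)) * cexp (-(π * I * (M ^ 2 * τ - M * τ - M + 2 * n * M))) *
      cexp (q (z + n + M * τ)) = cexp (q (z + n)) := by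
    rw [← Complex.exp_add, ← Complex.exp_add]
    congr 1
    simp only [hq]
    field_simp
    ring
  have e' : cexp (2 * π * I * (n * M : ℤ)) = 1 := by
    rw [Complex.exp_eq_one_iff]; exact ⟨n * M, by ring⟩
  refine mul_right_cancel₀ (Complex.exp_ne_zero (q (z + n + M * τ))) ?_
  rw [h2, ← e, e']
  ring

lemma exists_theta_add_lattice (n M : ℤ) : ∃ d : ℂ, d ≠ 0 ∧
    ∀ z, theta τ (z + n + M * τ) = d * cexp (-(2 * π * I * M * z)) * theta τ z := by
  obtain ⟨c, -, hc⟩ := exists_theta_eq_thetaProd hτ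
  obtain ⟨d, hd, hdz⟩ := exists_thetaProd_add_lattice hτ n M
  refine ⟨d * cexp (-(π * I * (n + M * τ))), by simp [hd, Complex.exp_ne_zero], fun z => ?_⟩
  rw [hc, hc, hdz]
  have : -(π * I * (z + n + M * τ)) = -(π * I * z) + -(π * I * (n + M * τ)) := by ring
  rw [this, Complex.exp_add]
  ring

lemma isTheta_theta_two_mul (b : ℂ) :
    IsTheta τ 4 (cexp (-(4 * π * I * (τ + b)))) (fun z => theta τ (2 * z + b)) where
  differentiable := by
    have := differentiable_theta hτ
    fun_prop
  add_one z := by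
    have : 2 * (z + 1) + b = 2 * z + b + 1 + 1 := by ring
    rw [this, theta_add_one hτ, theta_add_one hτ, neg_neg]
  add_tau z := by
    have : 2 * (z + τ) + b = 2 * z + b + τ + τ := by ring
    rw [this, theta_add_tau hτ, theta_add_tau hτ, ← mul_assoc, neg_mul_neg, ← Complex.exp_add,
      ← Complex.exp_add]
    congr 2
    push_cast
    ring

lemma isTheta_thetaDen (η : ℂ) (k : ℕ) : IsTheta τ (4 * k : ℕ)
    (cexp (-(4 * π * I * (k * τ + k * (k - 1) * η)))) (thetaDen τ η k) := by
  have h := IsTheta.prod (Finset.range k)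
    fun l _ => isTheta_theta_two_mul hτ (2 * (l : ℂ) * η)
  have hsum : ∑ l ∈ Finset.range k, -(4 * π * I * (τ + 2 * (l : ℂ) * η)) =
      -(4 * π * I * (k * τ + k * (k - 1) * η)) := by
    induction k with
    | zero => simp
    | succ k ih =>
      rw [Finset.sum_range_succ, ih (IsTheta.prod (Finset.range k)
        fun l _ => isTheta_theta_two_mul hτ (2 * (l : ℂ) * η))]
      push_cast
      ring
  rw [← Complex.exp_sum, hsum, Finset.card_range] at h
  have e : ((4 * k : ℕ) : ℤ) = k * 4 := by push_cast; ring
  rw [e]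
  exact h

lemma eventually_thetaDen_ne_zero (η : ℂ) (k : ℕ) :
    ∀ᶠ z in codiscrete ℂ, thetaDen τ η k z ≠ 0 := by
  have h : ∀ l ∈ Finset.range k, ∀ᶠ z in codiscrete ℂ, theta τ (2 * z + 2 * (l : ℂ) * η) ≠ 0 := by
    intro l _
    refine eventually_codiscrete_ne_zero (isTheta_theta_two_mul hτ _).differentiable
      (w := 1 / 4 - l * η) ?_
    convert theta_half_ne_zero hτ using 2
    ring
  filter_upwards [(Finset.eventually_all _).mpr h] with z hz
  exact Finset.prod_ne_zero_iff.mpr hz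

/-- The multiplier constant of the numerators `g P_k` for `g ∈ V_k(μ)`. -/
noncomputable def numConst (τ η μ : ℂ) (k : ℕ) : ℂ :=
  μ ^ k * cexp (-(4 * π * I * (k * τ + k * (k - 1) * η)))

lemma isQuasiPeriodic_div {η μ : ℂ} {k : ℕ} {h : ℂ → ℂ}
    (hh : IsTheta τ (4 * k : ℕ) (numConst τ η μ k) h) :
    IsQuasiPeriodic τ η μ k (fun z => h z / thetaDen τ η k z) where
  meromorphic z := (hh.differentiable.analyticAt z).meromorphicAt.div
    ((isTheta_thetaDen hτ η k).differentiable.analyticAt z).meromorphicAt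
  add_one := .of_forall fun z => by rw [hh.add_one, (isTheta_thetaDen hτ η k).add_one]
  add_tau := .of_forall fun z => by
    -- Only the nonzero multiplier is cancelled, so the identity also holds at zeros of the
    -- denominator, where division returns `0`.
    rw [hh.add_tau, (isTheta_thetaDen hτ η k).add_tau, numConst, mul_assoc (μ ^ k),
      mul_assoc (μ ^ k), mul_div_assoc, mul_div_mul_left]
    exact mul_ne_zero (Complex.exp_ne_zero _) (Complex.exp_ne_zero _)
  entire := ⟨h, hh.differentiable, by
    filter_upwards [eventually_thetaDen_ne_zero hτ η k] with z hz
    rw [div_mul_cancel₀ _ hz]⟩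

/-- The functional equations for the entire numerator hold off a discrete set, hence everywhere by
continuity. -/
lemma IsQuasiPeriodic.exists_isTheta {η μ : ℂ} {k : ℕ} {g : ℂ → ℂ}
    (hg : IsQuasiPeriodic τ η μ k g) : ∃ h, IsTheta τ (4 * k : ℕ) (numConst τ η μ k) h ∧
      ∀ᶠ z in codiscrete ℂ, g z = h z / thetaDen τ η k z := by
  obtain ⟨h, hd, he⟩ := hg.entire
  have hP := isTheta_thetaDen hτ η k
  have hc := hd.continuous
  refine ⟨h, ⟨hd, eq_of_eventually_codiscrete_eq (by fun_prop) hc ?_,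
    eq_of_eventually_codiscrete_eq (by fun_prop) (by fun_prop) ?_⟩, ?_⟩
  · filter_upwards [he, (tendsto_add_const_codiscrete 1).eventually he, hg.add_one] with z h1 h2 h3
    rw [← h1, ← h2, h3, hP.add_one]
  · filter_upwards [he, (tendsto_add_const_codiscrete τ).eventually he, hg.add_tau] with z h1 h2 h3
    rw [← h1, ← h2, h3, hP.add_tau, numConst]
    ring
  · filter_upwards [he, eventually_thetaDen_ne_zero hτ η k] with z h1 h2
    rw [← h1, mul_div_cancel_right₀ _ h2]

/-- Multiplication by `P_k` identifies `V_k(μ)` with a space of entire theta functions. -/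
lemma nonempty_thetaSpace_equiv_V (η μ : ℂ) (k : ℕ) :
    Nonempty (thetaSpace τ (4 * k : ℕ) (numConst τ η μ k) ≃ₗ[ℂ] V τ η μ k) := by
  let Φ : thetaSpace τ (4 * k : ℕ) (numConst τ η μ k) →ₗ[ℂ] V τ η μ k :=
    { toFun := fun h => ⟨((fun z => h.1 z / thetaDen τ η k z : ℂ → ℂ) : Germ (codiscrete ℂ) ℂ),
        _, isQuasiPeriodic_div hτ h.2, rfl⟩
      map_add' := fun f g => by
        ext
        refine Germ.coe_eq.mpr (.of_forall fun z => ?_)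
        simp [add_div]
      map_smul' := fun c f => by
        ext
        refine Germ.coe_eq.mpr (.of_forall fun z => ?_)
        simp [mul_div_assoc] }
  refine ⟨LinearEquiv.ofBijective Φ ⟨?_, ?_⟩⟩
  · intro f g hfg
    have h := Germ.coe_eq.mp (congrArg Subtype.val hfg)
    ext z
    refine eq_of_eventually_codiscrete_eq f.2.differentiable.continuous
      g.2.differentiable.continuous ?_ z
    filter_upwards [h, eventually_thetaDen_ne_zero hτ η k] with z h1 h2
    exact (div_left_inj' h2).mp h1
  · rintro ⟨_, g, hg, rfl⟩
    obtain ⟨h, hh, he⟩ := hg.exists_isTheta hτ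
    refine ⟨⟨h, hh⟩, Subtype.ext (Germ.coe_eq.mpr ?_)⟩
    filter_upwards [he] with z hz
    exact hz.symm

omit hτ in
lemma numConst_eq_exp {μ ν : ℂ} (hν : cexp (8 * I * π * ν) = μ) (η : ℂ) (k : ℕ) :
    numConst τ η μ k = cexp (2 * π * I * (4 * k * ν - 2 * k * τ - 2 * k * (k - 1) * η)) := by
  rw [numConst, ← hν, ← Complex.exp_nat_mul, ← Complex.exp_add]
  congr 1
  ring

omit hτ in
lemma exists_exp_eight_pi_I_mul_eq {μ : ℂ} (hμ : μ ≠ 0) :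
    ∃ ν : ℂ, cexp (8 * I * π * ν) = μ ∧ 0 ≤ ν.re ∧ ν.re < 1 / 4 := by
  obtain ⟨b, hb⟩ := exists_exp_two_pi_I_mul_eq hμ
  refine ⟨(b - ⌊b.re⌋) / 4, ?_, ?_, ?_⟩
  · rw [← hb, Complex.exp_eq_exp_iff_exists_int]
    exact ⟨-⌊b.re⌋, by push_cast; ring⟩
  · have := Int.fract_nonneg b.re
    simp
    linarith
  · have := Int.fract_lt_one b.re
    simp
    linarith

lemma IsTheta.exists_eq_prod_theta {η μ ν : ℂ} (hν : cexp (8 * I * π * ν) = μ) {k : ℕ}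
    (hk : 1 ≤ k) {h : ℂ → ℂ} (hh : IsTheta τ (4 * k : ℕ) (numConst τ η μ k) h) :
    ∃ (c : ℂ) (a : Fin (4 * k) → ℂ), ∑ i, a i = 2 * (k : ℂ) * ((k : ℂ) - 1) * η ∧
      ∀ z, h z = c * ∏ i, theta τ (z + a i - ν) := by
  classical
  let i₀ : Fin (4 * k) := ⟨0, by omega⟩
  by_cases hw : ∃ w, h w ≠ 0
  swap
  · push Not at hw
    -- Even for `h = 0` the sum condition must hold, so one coordinate carries it all.
    refine ⟨0, Pi.single i₀ (2 * (k : ℂ) * ((k : ℂ) - 1) * η), ?_, fun z => by simp [hw z]⟩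
    simp
  obtain ⟨w, hw⟩ := hw
  obtain ⟨c, m, a, hC, hform⟩ := hh.exists_eq_prod hτ (4 * k) hw
  obtain ⟨n, hn⟩ : ∃ n : ℤ, m * τ + ∑ i, a i =
      4 * k * ν - 2 * k * τ - 2 * k * (k - 1) * η + n := by
    have e1 : ∏ i, -cexp (2 * π * I * a i) = cexp (2 * π * I * ∑ i, a i) := by
      rw [Finset.prod_neg, ← Complex.exp_sum, ← Finset.mul_sum, Finset.card_fin, pow_mul]
      norm_num
    rw [numConst_eq_exp hν, e1, ← Complex.exp_add, eq_comm,
      Complex.exp_eq_exp_iff_exists_int] at hC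
    obtain ⟨n, hn⟩ := hC
    refine ⟨n, mul_left_cancel₀ two_pi_I_ne_zero ?_⟩
    linear_combination hn
  obtain ⟨c₀, hc₀, hθ⟩ := exists_theta_eq_thetaProd hτ
  obtain ⟨d, hd, hdz⟩ := exists_theta_add_lattice hτ n (-(m + 2 * k))
  have hprod : ∀ z, ∏ i, theta τ (z - a i) =
      c₀ ^ (4 * k) * cexp (-(π * I * (4 * k * z - ∑ i, a i))) * ∏ i, thetaProd τ (z - a i) := by
    intro z
    simp only [hθ, Finset.prod_mul_distrib, Finset.prod_const, Finset.card_fin]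
    rw [← Complex.exp_sum, Finset.sum_neg_distrib, ← Finset.mul_sum, Finset.sum_sub_distrib]
    simp
  -- This lattice vector corrects the sum of the `a i`. Its translation factor `exp(2πi(m + 2k)z)`
  -- times the `exp(-4πikz)` from the `4k` conversions of `thetaProd` to `theta` is the required
  -- `exp(2πimz)`.
  set s : Fin (4 * k) → ℂ := Pi.single i₀ (n + (-(m + 2 * k) : ℤ) * τ) with hs
  have hshift : ∀ z, ∏ i, theta τ (z - a i + s i) =
      d * cexp (-(2 * π * I * (-(m + 2 * k) : ℤ) * (z - a i₀))) * ∏ i, theta τ (z - a i) := by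
    intro z
    rw [← Finset.mul_prod_erase Finset.univ (fun i => theta τ (z - a i)) (Finset.mem_univ i₀),
      ← Finset.mul_prod_erase Finset.univ _ (Finset.mem_univ i₀), ← mul_assoc, ← hdz]
    congr 1
    · simp [hs, add_assoc]
    · refine Finset.prod_congr rfl fun i hi => ?_
      simp [hs, Finset.ne_of_mem_erase hi]
  refine ⟨c * (d * cexp (2 * π * I * (-(m + 2 * k) : ℤ) * a i₀) * c₀ ^ (4 * k) *
      cexp (π * I * ∑ i, a i))⁻¹,
    fun i => ν - a i + s i, ?_, fun z => ?_⟩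
  · rw [Finset.sum_add_distrib, Finset.sum_sub_distrib, hs, Finset.sum_pi_single']
    simp only [Finset.sum_const, Finset.card_fin, Finset.mem_univ, if_true, nsmul_eq_mul]
    push_cast
    linear_combination -hn
  · have e : ∀ i, z + (ν - a i + s i) - ν = z - a i + s i := fun i => by ring
    simp only [e]
    rw [hshift, hprod, hform]
    have e2 : cexp (2 * π * I * m * z) * cexp (2 * π * I * (-(m + 2 * k) : ℤ) * a i₀) *
        cexp (π * I * ∑ i, a i) = cexp (-(2 * π * I * (-(m + 2 * k) : ℤ) * (z - a i₀))) *
        cexp (-(π * I * (4 * k * z - ∑ i, a i))) := by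
      rw [← Complex.exp_add, ← Complex.exp_add, ← Complex.exp_add]
      congr 1
      push_cast
      ring
    rw [mul_assoc c, mul_assoc c, inv_mul_eq_div]
    congr 1
    rw [eq_div_iff (by simp [hd, hc₀, Complex.exp_ne_zero])]
    linear_combination (d * c₀ ^ (4 * k) * ∏ i, thetaProd τ (z - a i)) * e2

end

end Sklyanin

theorem proposition2p1 (τ : ℂ) (hτ : 0 < τ.im) (η μ : ℂ) (hμ : μ ≠ 0) (k : ℕ) (hk : 1 ≤ k) :
    FiniteDimensional ℂ (Sklyanin.V τ η μ k) ∧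
    Module.finrank ℂ (Sklyanin.V τ η μ k) = 4 * k ∧
    ∃ ν : ℂ, Complex.exp (8 * Complex.I * Real.pi * ν) = μ ∧ 0 ≤ ν.re ∧ ν.re < 1 / 4 ∧
      ∀ g ∈ Sklyanin.V τ η μ k, ∃ (c : ℂ) (a : Fin (4 * k) → ℂ),
        ∑ i, a i = 2 * (k : ℂ) * ((k : ℂ) - 1) * η ∧
        g = ((fun z : ℂ => c * (∏ i, Sklyanin.theta τ (z + a i - ν)) /
          Sklyanin.thetaDen τ η k z : ℂ → ℂ) : Filter.Germ (Filter.codiscrete ℂ) ℂ) := by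
  obtain ⟨e₁⟩ := Sklyanin.nonempty_thetaSpace_equiv_V hτ η μ k
  obtain ⟨e₂⟩ := Sklyanin.nonempty_thetaSpace_equiv hτ (N := 4 * k) (by omega)
    (C := Sklyanin.numConst τ η μ k) (mul_ne_zero (pow_ne_zero _ hμ) (Complex.exp_ne_zero _))
  have e := e₁.symm.trans e₂
  refine ⟨Module.Finite.equiv e.symm, by simpa using e.finrank_eq, ?_⟩
  obtain ⟨ν, hν, h0, h1⟩ := Sklyanin.exists_exp_eight_pi_I_mul_eq hμ
  refine ⟨ν, hν, h0, h1, ?_⟩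
  rintro _ ⟨g, hg, rfl⟩
  obtain ⟨h, hh, he⟩ := hg.exists_isTheta hτ
  obtain ⟨c, a, ha, hform⟩ := hh.exists_eq_prod_theta hτ hν hk
  refine ⟨c, a, ha, Germ.coe_eq.mpr ?_⟩
  filter_upwards [he] with z hz
  rw [hz, hform]
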